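/- Let $1<p<\infty$ and let $C_0$ be the discrete Cesàro operator on the complex Banach space $\ell^p=\ell^p(\mathbb{N}_0)$, that is, the bounded linear operator $$(C_0 f)(n)=\frac{1}{n+1}\sum_{k=0}^{n} f(k),\qquad f\in\ell^p,\ n\ge 0.$$ A complex number $\lambda$ is called an extended eigenvalue of a bounded linear operator $T$ on a complex Banach space $E$ if there is a nonzero bounded linear operator $X$ on $E$ such that $TX=\lambda XT$. If $\lambda\in\mathbb{C}$ is an extended eigenvalue of $C_0$ on $\ell^p$, then $\lambda$ is real and $\lambda\ge 1$. -/

import Mathlib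

open scoped ENNReal

/-- `X` is an extended eigenoperator of the bounded operator `T` corresponding to the complex
scalar `μ`: `X` is a nonzero bounded operator with `T X = μ X T`. -/
def IsExtendedEigenoperator {E : Type*} [NormedAddCommGroup E] [NormedSpace ℂ E]
    (T : E →L[ℂ] E) (μ : ℂ) (X : E →L[ℂ] E) : Prop :=
  X ≠ 0 ∧ T ∘L X = μ • (X ∘L T)

/-- `μ` is an extended eigenvalue of the bounded operator `T`: it has an extended eigenoperator. -/
def IsExtendedEigenvalue {E : Type*} [NormedAddCommGroup E] [NormedSpace ℂ E]
    (T : E →L[ℂ] E) (μ : ℂ) : Prop :=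
  ∃ X : E →L[ℂ] E, IsExtendedEigenoperator T μ X

/-- The sequence of arithmetic means `n ↦ (f 0 + ⋯ + f n) / (n + 1)`. -/
noncomputable def cesaroMean (f : ℕ → ℂ) (n : ℕ) : ℂ :=
  (1 / ((n : ℂ) + 1)) * ∑ k ∈ Finset.range (n + 1), f k

theorem cesaroMean_add (f g : ℕ → ℂ) : cesaroMean (f + g) = cesaroMean f + cesaroMean g := by
  ext n
  simp [cesaroMean, Finset.sum_add_distrib, mul_add]

theorem cesaroMean_smul (c : ℂ) (f : ℕ → ℂ) : cesaroMean (c • f) = c • cesaroMean f := by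
  ext n
  simp [cesaroMean, ← Finset.mul_sum, mul_left_comm]

theorem norm_cesaroMean_le (f : ℕ → ℂ) (n : ℕ) :
    ‖cesaroMean f n‖ ≤ (∑ k ∈ Finset.range (n + 1), ‖f k‖) / ((n : ℝ) + 1) := by
  have h0 : ‖(n : ℂ) + 1‖ = (n : ℝ) + 1 := by
    rw [← Nat.cast_add_one, Complex.norm_natCast, Nat.cast_add_one]
  rw [cesaroMean, norm_mul, norm_div, norm_one, h0, one_div, div_eq_inv_mul]
  exact mul_le_mul_of_nonneg_left (norm_sum_le _ _) (by positivity)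

/-- The pointwise inequality behind Hardy's inequality. -/
theorem hardy_step {p q : ℝ} (hpq : p.HolderConjugate q) {x y t : ℝ} (hx : 0 ≤ x) (hy : 0 ≤ y)
    (ht : 0 ≤ t) :
    x ^ p + (q - 1) * ((t + 1) * x ^ p - t * y ^ p)
      ≤ q * (x ^ (p - 1) * ((t + 1) * x - t * y)) := by
  have hp0 := hpq.pos
  have hq0 := hpq.symm.pos
  have hxx : x ^ (p - 1) * x = x ^ p := by
    rcases hx.eq_or_lt with rfl | hx'
    · rw [mul_zero, Real.zero_rpow hp0.ne']
    · rw [← Real.rpow_add_one hx'.ne', sub_add_cancel]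
  have hY := Real.young_inequality_of_nonneg (Real.rpow_nonneg hx (p - 1)) hy hpq.symm
  have h1 : (x ^ (p - 1)) ^ q = x ^ p := by
    rw [← Real.rpow_mul hx, hpq.sub_one_mul_conj]
  rw [h1] at hY
  have h2 : q * (x ^ p / q + y ^ p / p) = x ^ p + (q - 1) * y ^ p := by
    have h3 : q / p = q - 1 := by
      rw [div_eq_iff hp0.ne', hpq.symm.sub_one_mul_conj]
    calc _ = q * (x ^ p / q) + q / p * y ^ p := by ring
      _ = _ := by rw [h3, mul_div_cancel₀ _ hq0.ne']
  have h4 : q * (x ^ (p - 1) * y) ≤ x ^ p + (q - 1) * y ^ p := by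
    rw [← h2]; exact mul_le_mul_of_nonneg_left hY hq0.le
  have h5 := mul_le_mul_of_nonneg_left h4 ht
  have h6 : q * (x ^ (p - 1) * ((t + 1) * x - t * y))
      = q * (t + 1) * x ^ p - t * (q * (x ^ (p - 1) * y)) := by
    rw [← hxx]; ring
  rw [h6]
  linarith

/-- Hardy's inequality for finite sums. -/
theorem hardy_sum {p q : ℝ} (hpq : p.HolderConjugate q) (a : ℕ → ℝ) (ha : ∀ n, 0 ≤ a n) (N : ℕ) :
    ∑ n ∈ Finset.range N, ((∑ k ∈ Finset.range (n + 1), a k) / ((n : ℝ) + 1)) ^ p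
      ≤ q ^ p * ∑ n ∈ Finset.range N, a n ^ p := by
  have hp0 := hpq.pos
  have hq0 := hpq.symm.pos
  have hq1 := hpq.symm.lt
  set m : ℕ → ℝ := fun n => (∑ k ∈ Finset.range (n + 1), a k) / ((n : ℝ) + 1) with hm
  have hm0 : ∀ n : ℕ, 0 ≤ m n := fun n =>
    div_nonneg (Finset.sum_nonneg fun k _ => ha k) (by positivity)
  have hmul : ∀ n : ℕ, ((n : ℝ) + 1) * m n = ∑ k ∈ Finset.range (n + 1), a k := fun n =>
    mul_div_cancel₀ _ (by positivity)
  have key : ∀ N : ℕ, ∑ n ∈ Finset.range N, m n ^ p + (q - 1) * (N * m (N - 1) ^ p)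
      ≤ q * ∑ n ∈ Finset.range N, m n ^ (p - 1) * a n := by
    intro N
    induction N with
    | zero => simp
    | succ N ih =>
      rw [Finset.sum_range_succ, Finset.sum_range_succ]
      have hs := hardy_step hpq (hm0 N) (hm0 (N - 1)) (Nat.cast_nonneg (α := ℝ) N)
      have haN : ((N : ℝ) + 1) * m N - N * m (N - 1) = a N := by
        rw [hmul, Finset.sum_range_succ]
        rcases N with _ | k
        · simp
        · have := hmul k
          push_cast
          rw [this]; ring
      rw [haN] at hs
      rw [Nat.add_sub_cancel]
      push_cast
      linarith
  have hS : ∑ n ∈ Finset.range N, m n ^ p ≤ q * ∑ n ∈ Finset.range N, m n ^ (p - 1) * a n := by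
    have h := key N
    have h0 : 0 ≤ (q - 1) * (N * m (N - 1) ^ p) :=
      mul_nonneg (by linarith) (mul_nonneg (Nat.cast_nonneg _) (Real.rpow_nonneg (hm0 _) _))
    linarith
  have hH := Real.inner_le_Lp_mul_Lq_of_nonneg (Finset.range N) hpq.symm
    (f := fun n => m n ^ (p - 1)) (g := a)
    (fun n _ => Real.rpow_nonneg (hm0 n) _) (fun n _ => ha n)
  have h1 : ∀ n, (m n ^ (p - 1)) ^ q = m n ^ p := fun n => by
    rw [← Real.rpow_mul (hm0 n), hpq.sub_one_mul_conj]
  simp only [h1] at hH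
  change ∑ n ∈ Finset.range N, m n ^ p ≤ _
  set S := ∑ n ∈ Finset.range N, m n ^ p
  set A := ∑ n ∈ Finset.range N, a n ^ p with hA
  have hA0 : 0 ≤ A := Finset.sum_nonneg fun n _ => Real.rpow_nonneg (ha n) _
  have hS0 : 0 ≤ S := Finset.sum_nonneg fun n _ => Real.rpow_nonneg (hm0 n) _
  rcases hS0.eq_or_lt with h | hpos
  · rw [← h]; positivity
  have h2 : S ≤ q * (S ^ (1 / q) * A ^ (1 / p)) :=
    hS.trans (mul_le_mul_of_nonneg_left hH hq0.le)
  have h3 : S = S ^ (1 / p) * S ^ (1 / q) := by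
    rw [← Real.rpow_add hpos, one_div, one_div, hpq.inv_add_inv_eq_one, Real.rpow_one]
  have h4 : S ^ (1 / p) ≤ q * A ^ (1 / p) := by
    have hpq' : 0 < S ^ (1 / q) := Real.rpow_pos_of_pos hpos _
    refine le_of_mul_le_mul_right ?_ hpq'
    rw [← h3]; linarith
  have h5 := Real.rpow_le_rpow (Real.rpow_nonneg hS0 _) h4 hp0.le
  rwa [Real.mul_rpow hq0.le (Real.rpow_nonneg hA0 _), ← Real.rpow_mul hS0, ← Real.rpow_mul hA0,
    one_div_mul_cancel hp0.ne', Real.rpow_one, Real.rpow_one] at h5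

theorem cesaroMean_sum_le {p : ℝ≥0∞} [Fact (1 ≤ p)] (hp : 1 < p) (hp' : p < ∞)
    (f : lp (fun _ : ℕ => ℂ) p) (s : Finset ℕ) :
    ∑ n ∈ s, ‖cesaroMean f n‖ ^ p.toReal
      ≤ (Real.conjExponent p.toReal * ‖f‖) ^ p.toReal := by
  have h1 : 1 < p.toReal := by
    rw [← ENNReal.toReal_one]
    exact (ENNReal.toReal_lt_toReal ENNReal.one_ne_top hp'.ne).2 hp
  have hpq := Real.HolderConjugate.conjExponent h1
  obtain ⟨N, hN⟩ := s.exists_nat_subset_range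
  rw [Real.mul_rpow hpq.symm.pos.le (norm_nonneg f)]
  calc ∑ n ∈ s, ‖cesaroMean f n‖ ^ p.toReal
      ≤ ∑ n ∈ Finset.range N, ‖cesaroMean f n‖ ^ p.toReal :=
        Finset.sum_le_sum_of_subset_of_nonneg hN fun n _ _ => Real.rpow_nonneg (norm_nonneg _) _
    _ ≤ ∑ n ∈ Finset.range N,
          ((∑ k ∈ Finset.range (n + 1), ‖f k‖) / ((n : ℝ) + 1)) ^ p.toReal := by
        refine Finset.sum_le_sum fun n _ =>
          Real.rpow_le_rpow (norm_nonneg _) ?_ (by linarith)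
        exact norm_cesaroMean_le f n
    _ ≤ _ := (hardy_sum hpq (fun n => ‖f n‖) (fun n => norm_nonneg _) N).trans
        (mul_le_mul_of_nonneg_left (lp.sum_rpow_le_norm_rpow (by linarith) f _)
          (Real.rpow_nonneg hpq.symm.pos.le _))

/-- The discrete Cesàro operator on the complex Banach space `ℓ^p`, `1 < p < ∞`, as a bounded
linear operator: `(C f) n = (f 0 + ⋯ + f n) / (n + 1)`. -/
noncomputable def cesaroOperator (p : ℝ≥0∞) [Fact (1 ≤ p)] (hp : 1 < p) (hp' : p < ∞) :
    lp (fun _ : ℕ => ℂ) p →L[ℂ] lp (fun _ : ℕ => ℂ) p :=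
  LinearMap.mkContinuous
    { toFun := fun f => ⟨cesaroMean f, memℓp_gen' (cesaroMean_sum_le hp hp' f)⟩
      map_add' := fun f g => Subtype.ext (cesaroMean_add f g)
      map_smul' := fun c f => Subtype.ext (cesaroMean_smul c f) }
    (Real.conjExponent p.toReal)
    (fun f => by
      have h1 : 1 < p.toReal := by
        rw [← ENNReal.toReal_one]
        exact (ENNReal.toReal_lt_toReal ENNReal.one_ne_top hp'.ne).2 hp
      exact lp.norm_le_of_forall_sum_le (by linarith)
        (mul_nonneg (Real.HolderConjugate.conjExponent h1).symm.pos.le (norm_nonneg f))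
        (cesaroMean_sum_le hp hp' f))

/-- The defining formula of the operator. -/
theorem cesaroOperator_apply (p : ℝ≥0∞) [Fact (1 ≤ p)] (hp : 1 < p) (hp' : p < ∞)
    (f : lp (fun _ : ℕ => ℂ) p) (n : ℕ) :
    cesaroOperator p hp hp' f n = (1 / ((n : ℂ) + 1)) * ∑ k ∈ Finset.range (n + 1), f k :=
  rfl

/-! The transpose of `C` has the formal eigensequences `g_w(n) = ∏_{k<n} (1 - w/(k+1))`, with `w Cᵗ
g_w = g_w`. Their size is roughly `n^(-Re w)`, so, with `q` conjugate to `p`, those with `Re w >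
1/q` lie in `ℓ^q`, the dual of `ℓ^p`, while an eigenfunctional with parameter `z`, `Re z < 1/q`,
would be too large for the dual and must vanish (`functional_eq_zero_of_eq_mul_cesaroOperator`).

If `C X = μ X C`, the functional `g_w ∘ X` satisfies the same equation with parameter `μ w`. Unless
`μ` is real and at least `1`, some `w`, hence an open set of them, has `Re w > 1/q > Re (μ w)`
(`exists_re_lt_and_mul_re_lt`), so there `g_w` annihilates the range of `X`. By analyticity in `w`
this persists at `w = 1, 2, …`, where `g_w` is finitely supported and triangular; hence `X = 0`
(`eq_zero_of_tsum_cesaroEigenseq_eq_zero`). -/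

/-! ### The eigensequences of the transpose of the Cesàro operator -/

/-- The eigensequence of the transposed Cesàro matrix for the eigenvalue `w⁻¹`. -/
noncomputable def cesaroEigenseq (w : ℂ) (n : ℕ) : ℂ :=
  ∏ k ∈ Finset.range n, (1 - w / ((k : ℂ) + 1))

theorem cesaroEigenseq_succ (w : ℂ) (n : ℕ) :
    cesaroEigenseq w (n + 1) = cesaroEigenseq w n * (1 - w / ((n : ℂ) + 1)) :=
  Finset.prod_range_succ _ _

theorem differentiable_cesaroEigenseq (n : ℕ) :
    Differentiable ℂ fun w => cesaroEigenseq w n := by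
  unfold cesaroEigenseq
  fun_prop

theorem cesaroEigenseq_natCast_eq_zero {j n : ℕ} (h : j < n) :
    cesaroEigenseq ((j : ℂ) + 1) n = 0 := by
  refine Finset.prod_eq_zero (Finset.mem_range.2 h) ?_
  rw [div_self (Nat.cast_add_one_ne_zero j), sub_self]

theorem cesaroEigenseq_natCast_ne_zero (j : ℕ) : cesaroEigenseq ((j : ℂ) + 1) j ≠ 0 := by
  refine Finset.prod_ne_zero_iff.2 fun k hk h => ?_
  rw [sub_eq_zero, eq_comm, div_eq_one_iff_eq (Nat.cast_add_one_ne_zero k)] at h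
  have : j = k := by exact_mod_cast add_right_cancel h
  exact (Finset.mem_range.1 hk).ne' this

/-- For large `t`, the quadratic term of `|1 - w/t|²` is absorbed by lowering `Re w` to `s`. The
bound is put in the form `(t/(t+1))^s` so that products telescope. -/
theorem norm_one_sub_div_le {R s σ : ℝ} {w : ℂ} (hw : ‖w‖ ≤ R) (hs : 0 ≤ s) (hσ : σ ≤ w.re)
    {t : ℝ} (ht : 0 < t) (hst : s ≤ t) (hR : R ^ 2 ≤ 2 * (σ - s) * t) :
    ‖1 - w / (t : ℂ)‖ ≤ (t / (t + 1)) ^ s := by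
  have h1 : ‖1 - w / (t : ℂ)‖ ≤ 1 - s / t := by
    refine le_of_sq_le_sq ?_ (by rw [sub_nonneg, div_le_one ht]; exact hst)
    have hre : (1 - w / (t : ℂ)).re = 1 - w.re / t := by simp
    have him : (1 - w / (t : ℂ)).im = -(w.im / t) := by simp
    rw [← Complex.normSq_eq_norm_sq, Complex.normSq_apply, hre, him]
    have hw2 : w.re * w.re + w.im * w.im ≤ R ^ 2 := by
      rw [← Complex.normSq_apply, Complex.normSq_eq_norm_sq]
      exact pow_le_pow_left₀ (norm_nonneg _) hw 2
    have h2 : (w.re * w.re + w.im * w.im) / t ^ 2 ≤ 2 * (w.re - s) / t := by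
      rw [div_le_div_iff₀ (by positivity) ht]
      have : 2 * (σ - s) * t ≤ 2 * (w.re - s) * t := by gcongr
      nlinarith
    have h3 : (1 - w.re / t) * (1 - w.re / t) + -(w.im / t) * -(w.im / t)
        = 1 - 2 * w.re / t + (w.re * w.re + w.im * w.im) / t ^ 2 := by
      field_simp
      ring
    have h4 : (1 - s / t) ^ 2 = 1 - 2 * w.re / t + 2 * (w.re - s) / t + (s / t) ^ 2 := by
      field_simp
      ring
    rw [h3, h4]
    linarith [sq_nonneg (s / t)]
  have h2 : 1 - s / t ≤ Real.exp (-(s / t)) := by linarith [Real.add_one_le_exp (-(s / t))]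
  have h3 : ((t + 1) / t) ^ s ≤ Real.exp (s / t) := by
    have : (t + 1) / t ≤ Real.exp (1 / t) := by
      have := Real.add_one_le_exp (1 / t)
      rwa [add_div, div_self ht.ne', add_comm]
    calc _ ≤ Real.exp (1 / t) ^ s := Real.rpow_le_rpow (by positivity) this hs
      _ = _ := by rw [← Real.exp_mul, one_div_mul_eq_div]
  calc _ ≤ (Real.exp (s / t))⁻¹ := by rw [← Real.exp_neg]; exact h1.trans h2
    _ ≤ (((t + 1) / t) ^ s)⁻¹ := inv_anti₀ (by positivity) h3
    _ = _ := by rw [← Real.inv_rpow (by positivity), inv_div]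

theorem norm_cesaroEigenseq_le_pow {R : ℝ} {w : ℂ} (hw : ‖w‖ ≤ R) (n : ℕ) :
    ‖cesaroEigenseq w n‖ ≤ (1 + R) ^ n := by
  rw [cesaroEigenseq, norm_prod]
  refine (Finset.prod_le_prod (g := fun _ => 1 + R) (fun k _ => norm_nonneg _)
    fun k _ => ?_).trans_eq (by simp)
  refine (norm_sub_le _ _).trans ?_
  rw [norm_one, norm_div, ← Nat.cast_add_one, Complex.norm_natCast]
  gcongr
  refine (div_le_self (norm_nonneg w) ?_).trans hw
  exact_mod_cast Nat.succ_pos k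

/-- Beyond a fixed index the factor bounds telescope; the constant absorbs the earlier factors.
Uniformity in `w` is what the analyticity argument needs. -/
theorem exists_norm_cesaroEigenseq_le (R : ℝ) {s σ : ℝ} (hs : 0 ≤ s) (hsσ : s < σ) :
    ∃ C : ℝ, ∀ w : ℂ, ‖w‖ ≤ R → σ ≤ w.re → ∀ n : ℕ,
      ‖cesaroEigenseq w n‖ ≤ C * ((n : ℝ) + 1) ^ (-s) := by
  -- Past `K` both largeness conditions of `norm_one_sub_div_le` hold.
  obtain ⟨K, hK⟩ := exists_nat_ge (max s (R ^ 2 / (2 * (σ - s))))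
  have hKs : s ≤ K := (le_max_left _ _).trans hK
  have hKR : R ^ 2 ≤ 2 * (σ - s) * K := by
    have := (le_max_right _ _).trans hK
    rwa [div_le_iff₀' (by linarith)] at this
  refine ⟨(1 + R) ^ K * ((K : ℝ) + 1) ^ s, fun w hw hσ n => ?_⟩
  have hR : 0 ≤ R := (norm_nonneg w).trans hw
  rcases le_total n K with hn | hn
  · calc ‖cesaroEigenseq w n‖ ≤ (1 + R) ^ n := norm_cesaroEigenseq_le_pow hw n
      _ ≤ (1 + R) ^ K := pow_le_pow_right₀ (by linarith) hn
      _ = (1 + R) ^ K * (((n : ℝ) + 1) ^ s * ((n : ℝ) + 1) ^ (-s)) := by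
        rw [← Real.rpow_add (by positivity), add_neg_cancel, Real.rpow_zero, mul_one]
      _ ≤ (1 + R) ^ K * (((K : ℝ) + 1) ^ s * ((n : ℝ) + 1) ^ (-s)) := by gcongr
      _ = _ := by ring
  · induction n, hn using Nat.le_induction with
    | base =>
      rw [mul_assoc, ← Real.rpow_add (by positivity), add_neg_cancel, Real.rpow_zero, mul_one]
      exact norm_cesaroEigenseq_le_pow hw K
    | succ n hn ih =>
      have hnK : (K : ℝ) ≤ n := by exact_mod_cast hn
      have hstep := norm_one_sub_div_le (t := (n : ℝ) + 1) hw hs hσ (by positivity) (by linarith)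
        (hKR.trans (mul_le_mul_of_nonneg_left (by linarith) (by linarith)))
      rw [cesaroEigenseq_succ, norm_mul]
      push_cast at hstep ⊢
      refine (mul_le_mul ih hstep (norm_nonneg _) (by positivity)).trans_eq ?_
      rw [Real.div_rpow (by positivity) (by positivity), mul_assoc, Real.rpow_neg (by positivity),
        Real.rpow_neg (by positivity)]
      field_simp

theorem summable_rpow_neg_rpow {s q : ℝ} (h : 1 < s * q) :
    Summable fun n : ℕ => (((n : ℝ) + 1) ^ (-s)) ^ q := by
  have h1 := (summable_nat_add_iff 1).2 (Real.summable_nat_rpow.2 (neg_lt_neg h))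
  refine h1.congr fun n => ?_
  rw [← Real.rpow_mul (by positivity), Nat.cast_add_one, neg_mul]

theorem memℓp_cesaroEigenseq {q : ℝ≥0∞} (hq : 0 < q.toReal) {w : ℂ}
    (hw : q.toReal⁻¹ < w.re) : Memℓp (cesaroEigenseq w) q := by
  obtain ⟨s, hs1, hs2⟩ := exists_between hw
  have hs0 : 0 < s := (inv_pos.2 hq).trans hs1
  obtain ⟨C, hC⟩ := exists_norm_cesaroEigenseq_le ‖w‖ hs0.le hs2
  refine memℓp_gen ?_
  have hsq : 1 < s * q.toReal := by rwa [inv_lt_iff_one_lt_mul₀ hq] at hs1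
  refine Summable.of_nonneg_of_le (fun n => by positivity) (fun n => ?_)
    ((summable_rpow_neg_rpow hsq).mul_left (|C| ^ q.toReal))
  rw [← Real.mul_rpow (abs_nonneg _) (by positivity)]
  refine Real.rpow_le_rpow (norm_nonneg _) ((hC w le_rfl le_rfl n).trans ?_) hq.le
  gcongr
  exact le_abs_self C

/-! ### The pairing of `ℓ^p` with `ℓ^q` -/

/-- The bilinear pairing of `ℓ^q` with `ℓ^p`, as a functional on `ℓ^p`. -/
noncomputable def lpPairing {p q : ℝ≥0∞} [Fact (1 ≤ p)] (hpq : p.toReal.HolderConjugate q.toReal)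
    (g : lp (fun _ : ℕ => ℂ) q) : lp (fun _ : ℕ => ℂ) p →L[ℂ] ℂ :=
  have hsum (f : lp (fun _ : ℕ => ℂ) p) : Summable fun n => ‖g n * f n‖ := by
    simpa only [norm_mul] using lp.summable_mul hpq.symm g f
  LinearMap.mkContinuous
    { toFun := fun f => ∑' n, g n * f n
      map_add' := fun f f' => by
        rw [← (hsum f).of_norm.tsum_add (hsum f').of_norm]
        exact tsum_congr fun n => mul_add _ _ _
      map_smul' := fun c f => by
        rw [RingHom.id_apply, smul_eq_mul, ← tsum_mul_left]
        exact tsum_congr fun n => mul_left_comm _ _ _ }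
    ‖g‖
    (fun f => by
      refine (norm_tsum_le_tsum_norm (hsum f)).trans ?_
      simpa only [norm_mul] using lp.tsum_mul_le_mul_norm' hpq.symm g f)

/-- A nonzero limit would make the harmonic series converge by comparison. -/
theorem tendsto_succ_mul_eq_zero {a : ℕ → ℂ} {L : ℂ} (ha : Summable a)
    (h : Filter.Tendsto (fun n : ℕ => ((n : ℂ) + 1) * a n) Filter.atTop (nhds L)) : L = 0 := by
  by_contra hL
  have hL' : 0 < ‖L‖ := norm_pos_iff.2 hL
  have hev : ∀ᶠ n : ℕ in Filter.atTop, ‖L‖ / 2 < ‖((n : ℂ) + 1) * a n‖ :=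
    h.norm.eventually (lt_mem_nhds (by linarith))
  have hO : (fun n : ℕ => 1 / ((n + 1 : ℕ) : ℝ)) =O[Filter.atTop] a := by
    refine Asymptotics.IsBigO.of_bound (2 / ‖L‖) (hev.mono fun n hn => ?_)
    rw [norm_mul, ← Nat.cast_add_one, Complex.norm_natCast] at hn
    rw [Real.norm_of_nonneg (by positivity), div_le_iff₀ (by positivity),
      div_mul_eq_mul_div, div_mul_eq_mul_div, le_div_iff₀ hL']
    linarith
  have h1 := summable_of_isBigO_nat ha.norm (hO.trans (Asymptotics.isBigO_refl _ _).norm_right)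
  exact Real.not_summable_one_div_natCast ((summable_nat_add_iff 1).1 h1)

/-- Summation by parts, using `(n+1)(g_n - g_{n+1}) = w g_n`; the last summand is the boundary term.
-/
theorem sum_cesaroEigenseq_mul (w : ℂ) (h : ℕ → ℂ) (N : ℕ) :
    ∑ n ∈ Finset.range (N + 1), cesaroEigenseq w n * h n
      = w * ∑ n ∈ Finset.range N, cesaroEigenseq w n * cesaroMean h n
        + ((N : ℂ) + 1) * (cesaroEigenseq w N * cesaroMean h N) := by
  have hS : ∀ N : ℕ, ((N : ℂ) + 1) * cesaroMean h N = ∑ k ∈ Finset.range (N + 1), h k := fun N => by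
    rw [cesaroMean, ← mul_assoc, mul_one_div_cancel (Nat.cast_add_one_ne_zero N), one_mul]
  induction N with
  | zero => simp [cesaroMean]
  | succ N ih =>
    rw [Finset.sum_range_succ, ih, Finset.sum_range_succ (n := N)]
    have h1 := hS (N + 1)
    rw [Finset.sum_range_succ, ← hS N] at h1
    have h2 : h (N + 1) = (((N + 1 : ℕ) : ℂ) + 1) * cesaroMean h (N + 1)
        - ((N : ℂ) + 1) * cesaroMean h N := by rw [h1]; ring
    have h3 : (N : ℂ) + 1 ≠ 0 := Nat.cast_add_one_ne_zero N
    rw [h2, cesaroEigenseq_succ]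
    field_simp
    ring

/-- The eigenvalue equation `w Cᵗ g = g` for the eigensequence `g`, tested on `ℓ^p`. -/
theorem lpPairing_cesaroOperator {p q : ℝ≥0∞} [Fact (1 ≤ p)] (hp : 1 < p) (hp' : p < ∞)
    (hpq : p.toReal.HolderConjugate q.toReal) {w : ℂ} (g : lp (fun _ : ℕ => ℂ) q)
    (hg : ∀ n, g n = cesaroEigenseq w n) (h : lp (fun _ : ℕ => ℂ) p) :
    w * lpPairing hpq g (cesaroOperator p hp hp' h) = lpPairing hpq g h := by
  have hsum (f : lp (fun _ : ℕ => ℂ) p) : Summable fun n => g n * f n := by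
    refine Summable.of_norm ?_
    simpa only [norm_mul] using lp.summable_mul hpq.symm g f
  have h1 := ((Filter.tendsto_add_atTop_iff_nat 1).2 (hsum h).hasSum.tendsto_sum_nat)
  have h2 := (hsum (cesaroOperator p hp hp' h)).hasSum.tendsto_sum_nat.const_mul w
  have h3 := h1.sub h2
  -- The difference of partial sums is the boundary term; it converges, and its limit is zero
  -- because `g · C h` is summable.
  have h4 := tendsto_succ_mul_eq_zero (hsum (cesaroOperator p hp hp' h)) (h3.congr fun N => by
    have := sum_cesaroEigenseq_mul w h N
    simp only [← hg] at this
    rw [this]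
    exact add_sub_cancel_left _ _)
  exact (sub_eq_zero.1 h4).symm

/-- The partial sums of `e_n - e_{n+1}` form `e_n`. Testing on these vectors turns the eigenvalue
equation into a first-order recursion. -/
theorem cesaroOperator_single_sub_single (p : ℝ≥0∞) [Fact (1 ≤ p)] (hp : 1 < p) (hp' : p < ∞)
    (n : ℕ) :
    cesaroOperator p hp hp' (lp.single p n 1 - lp.single p (n + 1) 1)
      = (1 / ((n : ℂ) + 1)) • lp.single p n (1 : ℂ) := by
  ext m
  have hs : ∀ k : ℕ, ∑ i ∈ Finset.range (m + 1), (Pi.single k 1 : ℕ → ℂ) i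
      = if k ∈ Finset.range (m + 1) then 1 else 0 := fun k => Finset.sum_pi_single' k 1 _
  change (1 / ((m : ℂ) + 1)) * ∑ i ∈ Finset.range (m + 1),
      ((Pi.single n 1 : ℕ → ℂ) i - (Pi.single (n + 1) 1 : ℕ → ℂ) i)
    = (1 / ((n : ℂ) + 1)) * (Pi.single n 1 : ℕ → ℂ) m
  simp only [Finset.sum_sub_distrib, hs, Finset.mem_range]
  rcases lt_trichotomy m n with h | rfl | h
  · rw [if_neg (by lia), if_neg (by lia), Pi.single_eq_of_ne h.ne]
    simp
  · simp
  · rw [if_pos (by lia), if_pos (by lia), Pi.single_eq_of_ne h.ne']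
    simp

/-! ### Growth of solutions of the eigenvalue recursion -/

/-- Bernoulli's inequality for exponents in `[0, 1]`, applied to the real part. -/
theorem le_norm_one_sub_div {a : ℝ} (ha : 0 ≤ a) (ha1 : a ≤ 1) {z : ℂ} (hz : z.re ≤ a) {t : ℝ}
    (ht : 1 ≤ t) : ((t - 1) / t) ^ a ≤ ‖1 - z / (t : ℂ)‖ := by
  have ht0 : 0 < t := by linarith
  have h1 := rpow_one_add_le_one_add_mul_self (s := -(1 / t))
    (by rw [neg_le_neg_iff, div_le_one ht0]; exact ht) ha ha1
  have h2 : 1 + -(1 / t) = (t - 1) / t := by field_simp; ring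
  rw [h2] at h1
  refine h1.trans (le_trans ?_ (Complex.re_le_norm _))
  have h3 : (1 - z / (t : ℂ)).re = 1 - z.re / t := by simp
  have h4 : z.re / t ≤ a / t := by gcongr
  rw [h3, mul_neg, mul_one_div]
  linarith

/-- The lower bounds telescope. The start is at index `1` because at `t = 1` the bound of
`le_norm_one_sub_div` is zero when `a > 0`. -/
theorem le_norm_of_recursion {a : ℝ} (ha : 0 ≤ a) (ha1 : a ≤ 1) {z : ℂ} (hz : z.re ≤ a)
    {y : ℕ → ℂ} (hy : ∀ n : ℕ, y (n + 1) = y n * (1 - z / ((n : ℂ) + 1))) (n : ℕ) :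
    ‖y 1‖ * ((n : ℝ) + 1) ^ (-a) ≤ ‖y (n + 1)‖ := by
  induction n with
  | zero => simp
  | succ n ih =>
    have h := le_norm_one_sub_div ha ha1 hz (t := (n : ℝ) + 1 + 1) (by linarith [n.cast_nonneg (α := ℝ)])
    rw [hy (n + 1), norm_mul]
    rw [add_sub_cancel_right] at h
    push_cast at h ⊢
    refine le_trans (le_of_eq ?_) (mul_le_mul ih h (by positivity) (norm_nonneg _))
    rw [Real.div_rpow (by positivity) (by positivity),
      Real.rpow_neg (by positivity), Real.rpow_neg (by positivity)]
    field_simp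

/-- A bounded functional on `ℓ^p` cannot have coefficients as large as `n ^ (-1/q)`. -/
theorem nonpos_of_le_norm_functional {p : ℝ≥0∞} [Fact (1 ≤ p)] {q : ℝ}
    (hpq : p.toReal.HolderConjugate q) (Y : lp (fun _ : ℕ => ℂ) p →L[ℂ] ℂ) {c : ℝ}
    (hc : ∀ n : ℕ, c * ((n : ℝ) + 1) ^ (-q⁻¹) ≤ ‖Y (lp.single p (n + 1) 1)‖) : c ≤ 0 := by
  by_contra! hc0
  have hp0 := hpq.pos
  set H : ℕ → ℝ := fun N => ∑ n ∈ Finset.range N, 1 / ((n : ℝ) + 1) with hH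
  have hHtop : Filter.Tendsto H Filter.atTop Filter.atTop :=
    Real.tendsto_sum_range_one_div_nat_succ_atTop
  have hbound : ∀ N, c * H N ≤ ‖Y‖ * H N ^ p.toReal⁻¹ := by
    intro N
    have hH0 : 0 ≤ H N := Finset.sum_nonneg fun n _ => by positivity
    choose u hu1 hu2 using fun n : ℕ =>
      (show ∃ u : ℂ, ‖u‖ = 1 ∧ u * Y (lp.single p n 1) = ‖Y (lp.single p n 1)‖ from
        (RCLike.exists_norm_eq_mul_self (Y (lp.single p n 1))).imp fun _ h => ⟨h.1, h.2.symm⟩)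
    -- The test vector has moduli `n^(-1/p)` on `1, …, N`, with phases aligning the terms of `Y f`:
    -- then `‖f‖^p` is the harmonic sum `H N`, while `Y f ≥ c * H N`.
    set b : ℕ → ℂ := fun n => u n * ((n : ℝ) ^ (-p.toReal⁻¹) : ℝ) with hb
    set f : lp (fun _ : ℕ => ℂ) p :=
      ∑ n ∈ (Finset.range N).image (· + 1), lp.single p n (b n) with hf
    have hinj : Set.InjOn (· + 1) (Finset.range N : Set ℕ) := fun _ _ _ _ h => Nat.succ_injective h
    have hfnorm : ‖f‖ ^ p.toReal = H N := by
      rw [hf, lp.norm_sum_single hp0, Finset.sum_image hinj]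
      refine Finset.sum_congr rfl fun n _ => ?_
      rw [hb]
      simp only [norm_mul, hu1, one_mul, Complex.norm_real]
      rw [Real.norm_of_nonneg (by positivity), ← Real.rpow_mul (by positivity), neg_mul,
        inv_mul_cancel₀ hp0.ne', Real.rpow_neg_one, one_div, Nat.cast_add_one]
    have hfn : ‖f‖ = H N ^ p.toReal⁻¹ := by
      rw [← hfnorm, ← Real.rpow_mul (norm_nonneg _), mul_inv_cancel₀ hp0.ne', Real.rpow_one]
    have hYf : Y f = ((∑ n ∈ Finset.range N, ((n + 1 : ℕ) : ℝ) ^ (-p.toReal⁻¹)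
        * ‖Y (lp.single p (n + 1) 1)‖ : ℝ) : ℂ) := by
      rw [hf, map_sum, Finset.sum_image hinj, Complex.ofReal_sum]
      refine Finset.sum_congr rfl fun n _ => ?_
      have h1 : lp.single p (n + 1) (b (n + 1))
          = b (n + 1) • lp.single (E := fun _ : ℕ => ℂ) p (n + 1) (1 : ℂ) := by
        rw [← lp.single_smul, smul_eq_mul, mul_one]
      rw [h1, map_smul, smul_eq_mul, hb, Complex.ofReal_mul, ← hu2]
      ring
    rw [← hfn]
    refine le_trans ?_ (Y.le_opNorm f)
    rw [hYf, Complex.norm_real, hH, Finset.mul_sum]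
    refine le_trans (Finset.sum_le_sum fun n _ => ?_) (le_abs_self _)
    refine le_trans (le_of_eq ?_) (mul_le_mul_of_nonneg_left (hc n) (by positivity))
    rw [Nat.cast_add_one, mul_left_comm, ← Real.rpow_add (by positivity), ← neg_add,
      hpq.inv_add_inv_eq_one, Real.rpow_neg_one, one_div]
  -- Dividing by `H N ^ (1/p)` would leave `c * H N ^ (1/q)` bounded by `‖Y‖`, although `H`
  -- diverges.
  have hlim := (tendsto_rpow_atTop hpq.symm.inv_pos).comp hHtop
  obtain ⟨N, hN1, hN2⟩ := ((hlim.eventually_gt_atTop (‖Y‖ / c)).and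
    (hHtop.eventually_gt_atTop 0)).exists
  have h1 : H N = H N ^ q⁻¹ * H N ^ p.toReal⁻¹ := by
    rw [← Real.rpow_add hN2, hpq.symm.inv_add_inv_eq_one, Real.rpow_one]
  have h2 := hbound N
  rw [Function.comp_apply, div_lt_iff₀' hc0] at hN1
  have h3 := mul_lt_mul_of_pos_right hN1 (Real.rpow_pos_of_pos hN2 p.toReal⁻¹)
  rw [mul_assoc, ← h1] at h3
  exact h2.not_gt h3

/-- If `Y = z (Y ∘ C)` on `ℓ^p` with `Re z < 1/q`, then `Y` vanishes. -/
theorem functional_eq_zero_of_eq_mul_cesaroOperator {p : ℝ≥0∞} [Fact (1 ≤ p)] (hp : 1 < p)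
    (hp' : p < ∞) {q : ℝ} (hpq : p.toReal.HolderConjugate q)
    (Y : lp (fun _ : ℕ => ℂ) p →L[ℂ] ℂ) {z : ℂ} (hz : z.re < q⁻¹)
    (hY : ∀ f, Y f = z * Y (cesaroOperator p hp hp' f)) : Y = 0 := by
  set y : ℕ → ℂ := fun n => Y (lp.single p n 1) with hy
  have hrec : ∀ n : ℕ, y (n + 1) = y n * (1 - z / ((n : ℂ) + 1)) := fun n => by
    have h := hY (lp.single p n 1 - lp.single p (n + 1) 1)
    rw [cesaroOperator_single_sub_single, map_sub, map_smul, smul_eq_mul] at h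
    have h' : y n - y (n + 1) = z * (1 / ((n : ℂ) + 1) * y n) := h
    linear_combination -h'
  have hq1 : q⁻¹ < 1 := inv_lt_one_of_one_lt₀ hpq.symm.lt
  have hy1 : y 1 = 0 := norm_le_zero_iff.1 <| nonpos_of_le_norm_functional hpq Y
    (le_norm_of_recursion hpq.symm.inv_pos.le hq1.le hz.le hrec)
  -- Recovering `y 0` from `y 1 = y 0 * (1 - z)` requires `z ≠ 1`.
  have hz1 : 1 - z ≠ 0 := fun h => by
    rw [← sub_eq_zero.1 h, Complex.one_re] at hz
    linarith
  have hy0 : ∀ n, y n = 0 := fun n => by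
    rcases n with _ | n
    · have h := hrec 0
      rw [zero_add, hy1, Nat.cast_zero, zero_add, div_one] at h
      exact (mul_eq_zero.1 h.symm).resolve_right hz1
    · induction n with
      | zero => exact hy1
      | succ n ih => rw [hrec, ih, zero_mul]
  refine lp.ext_continuousLinearMap hp'.ne fun n => ?_
  ext
  exact hy0 n

/-! ### Completeness of the eigensequences -/

/-- If the pairing of a sequence in `ℓ^p` with the eigensequences vanishes on a nonempty open set
of parameters, then the sequence is zero. -/
theorem eq_zero_of_tsum_cesaroEigenseq_eq_zero {p : ℝ≥0∞} [Fact (1 ≤ p)] {q : ℝ}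
    (hpq : p.toReal.HolderConjugate q) (h : lp (fun _ : ℕ => ℂ) p) {w₀ : ℂ} (hw₀ : q⁻¹ < w₀.re)
    (hev : ∀ᶠ w in nhds w₀, ∑' n, cesaroEigenseq w n * h n = 0) : h = 0 := by
  have hq1 : q⁻¹ < 1 := inv_lt_one_of_one_lt₀ hpq.symm.lt
  -- Since `1/q < 1`, the half-plane `Re w > σ` can contain both `w₀` and every `j + 1`.
  obtain ⟨σ, hqσ, hσ⟩ := exists_between (lt_min hw₀ hq1)
  obtain ⟨s, hqs, hsσ⟩ := exists_between hqσ
  have hs0 : 0 < s := hpq.symm.inv_pos.trans hqs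
  have hsq : 1 < s * q := by rwa [inv_lt_iff_one_lt_mul₀ hpq.symm.pos] at hqs
  have hvan : ∀ j : ℕ, ∑' n, cesaroEigenseq ((j : ℂ) + 1) n * h n = 0 := by
    intro j
    -- The decay bound is uniform only on bounded sets, so the identity theorem is applied in a ball
    -- large enough for `w₀` and `j + 1`.
    set R : ℝ := max (‖w₀‖ + 1) (j + 2)
    obtain ⟨C, hC⟩ := exists_norm_cesaroEigenseq_le R hs0.le hsσ
    set U : Set ℂ := {w | σ < w.re} ∩ Metric.ball 0 R with hU
    have hUo : IsOpen U := (isOpen_lt continuous_const Complex.continuous_re).inter Metric.isOpen_ball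
    have hUc : IsPreconnected U :=
      ((convex_halfSpace_re_gt σ).inter (convex_ball 0 R)).isPreconnected
    have hsum : Summable fun n : ℕ => C * (((n : ℝ) + 1) ^ (-s) * ‖h n‖) :=
      (Real.summable_mul_of_Lp_Lq_of_nonneg hpq.symm (fun n => by positivity)
        (fun n => norm_nonneg _) (summable_rpow_neg_rpow hsq)
        ((lp.memℓp h).summable hpq.pos)).mul_left C
    have hdiff := Complex.differentiableOn_tsum_of_summable_norm (U := U)
      (F := fun n w => cesaroEigenseq w n * h n) hsum
      (fun n => ((differentiable_cesaroEigenseq n).mul_const _).differentiableOn) hUo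
      (fun n w hw => by
        rw [norm_mul, ← mul_assoc]
        gcongr
        exact hC w (mem_ball_zero_iff.1 hw.2).le (le_of_lt hw.1) n)
    refine (hdiff.analyticOnNhd hUo).eqOn_zero_of_preconnected_of_eventuallyEq_zero hUc
      (z₀ := w₀) ⟨hσ.trans_le (min_le_left _ _), ?_⟩ hev ⟨?_, ?_⟩
    · rw [mem_ball_zero_iff]
      exact (lt_add_one _).trans_le (le_max_left _ _)
    · have h1 : σ < 1 := hσ.trans_le (min_le_right _ _)
      have h2 : (0 : ℝ) ≤ j := j.cast_nonneg
      change σ < ((j : ℂ) + 1).re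
      rw [Complex.add_re, Complex.natCast_re, Complex.one_re]
      linarith
    · rw [mem_ball_zero_iff, ← Nat.cast_add_one, Complex.norm_natCast]
      refine lt_of_lt_of_le ?_ (le_max_right _ _)
      push_cast
      linarith
  ext j
  induction j using Nat.strong_induction_on with
  | _ j ih =>
    have h1 := hvan j
    -- Terms before `j` vanish by induction, terms after `j` because the eigensequence at `j + 1`
    -- stops at `j`.
    rw [tsum_eq_single j fun n hn => ?_] at h1
    · exact (mul_eq_zero.1 h1).resolve_left (cesaroEigenseq_natCast_ne_zero j)
    · rcases hn.lt_or_gt with hn | hn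
      · rw [ih n hn]
        exact mul_zero _
      · rw [cesaroEigenseq_natCast_eq_zero hn, zero_mul]

/-! ### Choice of the parameter and conclusion -/

theorem exists_re_lt_and_mul_re_lt {a : ℝ} (ha : 0 < a) (ha1 : a < 1) {μ : ℂ}
    (hμ : ¬(μ.im = 0 ∧ 1 ≤ μ.re)) : ∃ w : ℂ, a < w.re ∧ (μ * w).re < a := by
  by_cases him : μ.im = 0
  · have hre : μ.re < 1 := not_le.1 fun h => hμ ⟨him, h⟩
    rcases le_or_gt μ.re 0 with h0 | h0
    · refine ⟨1, by simpa using ha1, ?_⟩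
      rw [mul_one]
      linarith
    -- The midpoint of `a` and `a/μ`.
    · refine ⟨((a * (1 + μ.re⁻¹) / 2 : ℝ) : ℂ), ?_, ?_⟩
      · rw [Complex.ofReal_re]
        have := (one_lt_inv₀ h0).2 hre
        nlinarith
      · rw [Complex.re_mul_ofReal]
        have : μ.re * (a * (1 + μ.re⁻¹) / 2) = a * (μ.re + 1) / 2 := by
          field_simp
        rw [this]
        nlinarith
  -- For non-real `μ`, moving along `Re w = 1` gives `Re (μ w)` any value; here it is `0`.
  · refine ⟨⟨1, μ.re / μ.im⟩, ha1, ?_⟩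
    rw [Complex.mul_re]
    simp only [mul_one, mul_div_cancel₀ _ him, sub_self, ha]

theorem mainTheorem3 (p : ℝ≥0∞) [Fact (1 ≤ p)] (hp : 1 < p) (hp' : p < ∞) (μ : ℂ)
    (hμ : IsExtendedEigenvalue (cesaroOperator p hp hp') μ) :
    μ.im = 0 ∧ 1 ≤ μ.re := by
  by_contra hcon
  obtain ⟨X, hX0, hX⟩ := hμ
  have hp1 : 1 < p.toReal := by
    rw [← ENNReal.toReal_one]
    exact (ENNReal.toReal_lt_toReal ENNReal.one_ne_top hp'.ne).2 hp
  obtain ⟨q, hpq⟩ : ∃ q : ℝ≥0∞, p.toReal.HolderConjugate q.toReal := by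
    have h := Real.HolderConjugate.conjExponent hp1
    exact ⟨ENNReal.ofReal _, by rwa [ENNReal.toReal_ofReal h.symm.nonneg]⟩
  obtain ⟨w₀, hw₀, hμw₀⟩ := exists_re_lt_and_mul_re_lt hpq.symm.inv_pos
    (inv_lt_one_of_one_lt₀ hpq.symm.lt) hcon
  have hopen : IsOpen {w : ℂ | q.toReal⁻¹ < w.re ∧ (μ * w).re < q.toReal⁻¹} :=
    (isOpen_lt continuous_const Complex.continuous_re).inter
      (isOpen_lt (Complex.continuous_re.comp (continuous_const_mul μ)) continuous_const)
  refine hX0 (ContinuousLinearMap.ext fun f => ?_)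
  refine eq_zero_of_tsum_cesaroEigenseq_eq_zero hpq (X f) hw₀ ?_
  filter_upwards [hopen.mem_nhds ⟨hw₀, hμw₀⟩] with w hw
  set g : lp (fun _ : ℕ => ℂ) q := ⟨cesaroEigenseq w, memℓp_cesaroEigenseq hpq.symm.pos hw.1⟩
  -- Moving `C` past `X` costs the factor `μ`, so `g ∘ X` is an eigenfunctional with parameter `μ
  -- w`, outside the admissible half-plane.
  have hY := functional_eq_zero_of_eq_mul_cesaroOperator hp hp' hpq (lpPairing hpq g ∘L X) hw.2
    fun f => by
      have h1 := lpPairing_cesaroOperator hp hp' hpq g (fun _ => rfl) (X f)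
      have h2 : cesaroOperator p hp hp' (X f) = μ • X (cesaroOperator p hp hp' f) :=
        congrArg (fun A : lp (fun _ : ℕ => ℂ) p →L[ℂ] lp (fun _ : ℕ => ℂ) p => A f) hX
      rw [h2, map_smul, smul_eq_mul] at h1
      change lpPairing hpq g (X f) = μ * w * lpPairing hpq g (X (cesaroOperator p hp hp' f))
      rw [← h1]
      ring
  exact congrArg (fun A : lp (fun _ : ℕ => ℂ) p →L[ℂ] ℂ => A f) hY
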